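/- Let $cK=\langle a,b\mid [aba^{-1}b,a]=[b,aba^{-1}b]=1\rangle$, write $t=aba^{-1}b$, and for $k,m,n\in\mathbb Z$ let $(k,m,n)$ denote the element $t^k b^m a^n$ of $cK$. A geodesic representative of an element is a word in the free group $F(a,b)$ that represents it and has minimal length. The standard representative of $(k,m,n)$ is $b^{k+m}ab^{k}a^{n-1}$ if $n\ge 0$, and $b^{k+m}a^{-1}b^{k}a^{n+1}$ if $n<0$ (freely reduced). Draw a word as a polyline in $\mathbb Z^2$ starting at $(0,0)$: $a^{\pm1}$ is a step $(\pm1,0)$, and $b^{\pm1}$ at abscissa $x$ is a step $(0,\pm(-1)^x)$. Let $R=R(k,m,n)$ be the rectangle of all points with abscissa between $0$ and $n$ and ordinate between $\min(0,k+m)-\max(0,k)$ and $\max(0,k+m)-\min(0,k)$. The polyline of a geodesic representative of $(k,m,n)$ with $n\neq 0$ cuts $R$ into an upper and a lower part. A diagram of the upper (lower) part is the piece of that part over an interval of columns of $R$ such that the piece is a Young diagram with its corner at the left or right end of the interval on the top (bottom) side of $R$, and the interval is maximal with this property. A basic move changes a geodesic representative $w$ of $(k,m,n)$ (as a reduced word)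 into a word $w'$ in one of the following ways. 1. Even castling: a subword $b^{\varepsilon}a^{2\sigma}$ is replaced by $a^{2\sigma}b^{\varepsilon}$, or conversely ($\varepsilon,\sigma\in\{1,-1\}$). 2. Detowering: a subword $b^{\varepsilon x}a^{\sigma}b^{\varepsilon x}$ with $x\ge 1$ is replaced by $b^{\varepsilon(x-1)}a^{\sigma}b^{\varepsilon(x-1)}$ and, at the same time, another letter $a^{\sigma'}$ of $w$, outside this subword, is replaced by $b^{\varepsilon}a^{\sigma'}b^{\varepsilon}$ ($\varepsilon,\sigma,\sigma'\in\{1,-1\}$). 3. Clipping: two unit squares of $R$ are both added to the upper part (and so deleted from the lower part), or both added to the lower part (and so deleted from the upper part), by replacing two disjoint subwords, each by an exchange $b^{\varepsilon}a^{\sigma}\leftrightarrow a^{\sigma}b^{-\varepsilon}$ that moves the polyline across one of the squares; here the difference of the abscissae of the lower left corners of the two squares is odd, and in either part each of the two squares has its column in a diagram of that part that is still a Young diagram with the same corner after the change. Theorem. Let $k,m,n\in\mathbb Z$ with $n\neq0$ or $k=0$. Then the standard representative of $(k,m,n)$ is geodesic, and every geodesic representative of $(k,m,n)$ can be obtained from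 it by finitely many basic moves. -/

import Mathlib

namespace CK

/-- The two generators. -/
inductive Gen where
  | a
  | b
deriving DecidableEq

/-- Letters `a^{±1}`, `b^{±1}`; the Boolean is `true` for the generator and `false` for its inverse,
as in `FreeGroup`. -/
abbrev Letter := Gen × Bool

abbrev aLetter (s : Bool) : Letter := (Gen.a, s)
abbrev bLetter (s : Bool) : Letter := (Gen.b, s)

/-- The free generators `a` and `b` of the free group on `{a, b}`. -/
def fa : FreeGroup Gen := FreeGroup.of Gen.a
def fb : FreeGroup Gen := FreeGroup.of Gen.b

/-- The word `{a,b} = a b a⁻¹ b`. -/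
def ft : FreeGroup Gen := fa * fb * fa⁻¹ * fb

/-- The group `cK = ⟨a, b ∣ [a b a⁻¹ b, a] = [b, a b a⁻¹ b] = 1⟩`. -/
abbrev cK : Type := PresentedGroup
  ({ft * fa * ft⁻¹ * fa⁻¹, fb * ft * fb⁻¹ * ft⁻¹} : Set (FreeGroup Gen))

/-- The element of `cK` represented by a word. -/
def toCK : FreeGroup Gen →* cK := PresentedGroup.mk _

/-- The element `(k, m, n) = {a,b}^k b^m a^n` of `cK`. -/
def elt (k m n : ℤ) : cK := toCK ft ^ k * toCK fb ^ m * toCK fa ^ n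

/-- `w` is a geodesic representative of `g`: it represents `g`, and no word representing `g` is
shorter (`FreeGroup.norm` is the length of the reduced word). -/
def IsGeodesicRep (w : FreeGroup Gen) (g : cK) : Prop :=
  toCK w = g ∧ ∀ v : FreeGroup Gen, toCK v = g → w.norm ≤ v.norm

/-- The standard representative of `(k, m, n)`: the word `b^(k+m) a b^k a^(n-1)` for `n ≥ 0`, and
its mirror image under `a ↦ a⁻¹` for `n < 0`. -/
def standard (k m n : ℤ) : FreeGroup Gen :=
  if 0 ≤ n then fb ^ (k + m) * fa * fb ^ k * fa ^ (n - 1)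
  else fb ^ (k + m) * fa⁻¹ * fb ^ k * fa ^ (n + 1)

/-! ### Even castling and detowering -/

/-- Even castling: a subword `b^{±1} a²` is exchanged with `a² b^{±1}` (or `a⁻²` for `a²`). -/
inductive Castling : List Letter → List Letter → Prop
  | right (u v : List Letter) (e s : Bool) :
      Castling (u ++ [bLetter e, aLetter s, aLetter s] ++ v)
        (u ++ [aLetter s, aLetter s, bLetter e] ++ v)
  | left (u v : List Letter) (e s : Bool) :
      Castling (u ++ [aLetter s, aLetter s, bLetter e] ++ v)
        (u ++ [bLetter e, aLetter s, aLetter s] ++ v)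

/-- The subword `b^{±x} a^{±1} b^{±x}`, with the same sign at both powers of `b`. In the plane this
is a tower of width one, since at odd abscissae `b` points in the opposite direction. -/
def tower (x : ℕ) (e s : Bool) : List Letter :=
  List.replicate x (bLetter e) ++ [aLetter s] ++ List.replicate x (bLetter e)

/-- Detowering: a tower `b^{±x} a b^{±x}`, `x ≥ 1`, is lowered to `b^{±(x-1)} a b^{±(x-1)}`, and
another letter `a` of the word is replaced by `b^{±1} a b^{±1}` at the same time. -/
inductive Detowering : List Letter → List Letter → Prop
  | right (u v z : List Letter) (x : ℕ) (e s s' : Bool) :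
      Detowering (u ++ tower (x + 1) e s ++ v ++ [aLetter s'] ++ z)
        (u ++ tower x e s ++ v ++ [bLetter e, aLetter s', bLetter e] ++ z)
  | left (u v z : List Letter) (x : ℕ) (e s s' : Bool) :
      Detowering (u ++ [aLetter s'] ++ v ++ tower (x + 1) e s ++ z)
        (u ++ [bLetter e, aLetter s', bLetter e] ++ v ++ tower x e s ++ z)

/-! ### The polyline of a word -/

def sgn (s : Bool) : ℤ := if s then 1 else -1

/-- The Cayley graph of the Klein bottle group on the integer lattice, with `b^y a^x` at the point
`(x, y)`: `a` moves to the right, `b` moves up at even abscissae and down at odd abscissae. -/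
def step : ℤ × ℤ → Letter → ℤ × ℤ
  | (x, y), (Gen.a, s) => (x + sgn s, y)
  | (x, y), (Gen.b, s) => (x, if Even x then y + sgn s else y - sgn s)

/-- The end point of the polyline that a word draws from the origin. -/
def endpoint (w : List Letter) : ℤ × ℤ := w.foldl step (0, 0)

/-- The polyline of `w` runs along the unit edge between `P` and `Q`, in one of the directions. -/
def HasEdge (w : List Letter) (P Q : ℤ × ℤ) : Prop :=
  ∃ (u v : List Letter) (x : Letter), w = u ++ x :: v ∧
    ((endpoint u = P ∧ endpoint (u ++ [x]) = Q) ∨ (endpoint u = Q ∧ endpoint (u ++ [x]) = P))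

/-- A unit square of the lattice, given by its lower left corner. -/
abbrev Cell := ℤ × ℤ

/-! ### The rectangle of `(k, m, n)` and the Young diagrams cut out of it -/

/-- Bottom of the rectangle: `-k` if `k, k+m ≥ 0`; `k+m` if `k, k+m ≤ 0`; `0` if
`k ≤ 0 ≤ k+m`; `m` if `k+m ≤ 0 ≤ k`. -/
def bottom (k m : ℤ) : ℤ := min 0 (k + m) - max 0 k

/-- Top of the rectangle: `k+m` if `k, k+m ≥ 0`; `-k` if `k, k+m ≤ 0`; `m` if
`k ≤ 0 ≤ k+m`; `0` if `k+m ≤ 0 ≤ k`. -/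
def top (k m : ℤ) : ℤ := max 0 (k + m) - min 0 k

/-- The squares of the rectangle with abscissae between `0` and `n` and ordinates between
`bottom k m` and `top k m`. -/
def rect (k m n : ℤ) : Set Cell :=
  {c | min 0 n ≤ c.1 ∧ c.1 < max 0 n ∧ bottom k m ≤ c.2 ∧ c.2 < top k m}

inductive Side where
  | above
  | below

/-- The part of the rectangle above, or below, the polyline of `w`. -/
def part (k m n : ℤ) (w : List Letter) : Side → Set Cell
  | Side.above => {c | c ∈ rect k m n ∧ ∃ h, HasEdge w (c.1, h) (c.1 + 1, h) ∧ h ≤ c.2}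
  | Side.below => {c | c ∈ rect k m n ∧ ∃ h, HasEdge w (c.1, h) (c.1 + 1, h) ∧ c.2 < h}

/-- A Young diagram drawn in the plane: its corner square is `c`, its rows extend in the horizontal
direction `dx = ±1`, its columns in the vertical direction `dy = ±1`. -/
def drawn (c : Cell) (dx dy : ℤ) (μ : YoungDiagram) : Set Cell :=
  {d | ∃ i j : ℕ, (i, j) ∈ μ ∧ d = (c.1 + dx * j, c.2 + dy * i)}

/-- The ordinate of the squares along the side of the rectangle that bounds the given part. -/
def baseRow (k m : ℤ) : Side → ℤ
  | Side.above => top k m - 1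
  | Side.below => bottom k m

/-- The vertical direction from that side into the rectangle. -/
def inward : Side → ℤ
  | Side.above => -1
  | Side.below => 1

/-- Over the abscissae `p ≤ x < q` the set `P` is a Young diagram (possibly empty) that stands on
the top or the bottom side of the rectangle, with its corner at the left end of the strip
(`l = true`) or at the right end (`l = false`). -/
def IsYoungOver (k m : ℤ) (s : Side) (P : Set Cell) (p q : ℤ) (l : Bool) : Prop :=
  ∃ μ : YoungDiagram, {c | c ∈ P ∧ p ≤ c.1 ∧ c.1 < q} =
    drawn (if l then p else q - 1, baseRow k m s) (if l then 1 else -1) (inward s) μ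

/-- The part of the rectangle on side `s` of the polyline, over the abscissae `p ≤ x < q`, is one of
the Young diagrams into which the polyline cuts that part: it is a Young diagram and it is not
contained in one over a larger strip. -/
def IsDiagram (k m n : ℤ) (w : List Letter) (s : Side) (p q : ℤ) (l : Bool) : Prop :=
  min 0 n ≤ p ∧ p < q ∧ q ≤ max 0 n ∧ IsYoungOver k m s (part k m n w s) p q l ∧
    ∀ (p' q' : ℤ) (l' : Bool), min 0 n ≤ p' → p' ≤ p → q ≤ q' → q' ≤ max 0 n →
      IsYoungOver k m s (part k m n w s) p' q' l' → p' = p ∧ q' = q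

/-! ### Clipping -/

/-- Exchange of two neighbouring letters: `b^{±1} a ↔ a b^{∓1}` (or `a⁻¹` for `a`). The old and the
new subword run along the two halves of the boundary of one square. -/
inductive CornerSwap : List Letter → List Letter → Prop
  | ba (e s : Bool) : CornerSwap [bLetter e, aLetter s] [aLetter s, bLetter (!e)]
  | ab (e s : Bool) : CornerSwap [aLetter s, bLetter e] [bLetter (!e), aLetter s]

/-- The square with opposite corners `P` and `Q`. -/
def cellBetween (P Q : ℤ × ℤ) : Cell := (min P.1 Q.1, min P.2 Q.2)

/-- Clipping: two squares `c`, `d` of the rectangle at odd horizontal distance, at each of which the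
polyline turns, are both added to one part of the rectangle (so both are deleted from the other
part) by exchanging letters at the two turns; on either side, the Young diagrams to which the
squares are added, or from which they are deleted, remain Young diagrams. -/
def Clipping (k m n : ℤ) (w w' : List Letter) : Prop :=
  ∃ (u x x' v y y' z : List Letter) (c d : Cell),
    w = u ++ x ++ v ++ y ++ z ∧ w' = u ++ x' ++ v ++ y' ++ z ∧
    CornerSwap x x' ∧ CornerSwap y y' ∧
    c = cellBetween (endpoint u) (endpoint (u ++ x)) ∧
    d = cellBetween (endpoint (u ++ x ++ v)) (endpoint (u ++ x ++ v ++ y)) ∧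
    Odd (c.1 - d.1) ∧ c ∈ rect k m n ∧ d ∈ rect k m n ∧
    (∃ s : Side, c ∉ part k m n w s ∧ d ∉ part k m n w s ∧
      part k m n w' s = part k m n w s ∪ {c, d}) ∧
    ∀ (s : Side) (f : Cell), f = c ∨ f = d →
      ∃ (p q : ℤ) (l : Bool), p ≤ f.1 ∧ f.1 < q ∧ IsDiagram k m n w s p q l ∧
        IsYoungOver k m s (part k m n w' s) p q l

/-- `w'` is obtained by one basic move from the geodesic representative `w` of `(k, m, n)`. -/
def BasicMove (k m n : ℤ) (w w' : FreeGroup Gen) : Prop :=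
  IsGeodesicRep w (elt k m n) ∧
    (Castling w.toWord w'.toWord ∨ Detowering w.toWord w'.toWord ∨
      Clipping k m n w.toWord w'.toWord)

end CK

/-!
The element of `cK` represented by a word is determined by three exponent sums (`expSums`): of the
letters `b^{±1}` at even abscissae, of those at odd abscissae, and of the letters `a^{±1}`; for
`(k, m, n)` they are `k + m`, `k` and `n` (`toCK_mk_eq_elt_iff`). Soundness comes from letting `cK`
act on such triples, completeness from `t` being central and `a b a⁻¹ = t b⁻¹`. Hence
`|k + m| + |k| + |n|` bounds the length from below. If `n ≠ 0` or `k = 0` the standard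
representative attains this bound, so a geodesic is the same as a *directed* word for `(k, m, n)`,
one without letters of opposite sign among the three kinds (`IsGeodesicRep.directed`).

A directed word is therefore a distribution of `|k + m|` letters over the even columns and `|k|`
letters over the odd ones, and the standard representative is the one that puts them all into the
first two columns. Any other directed word has a letter `b^{±1}` that can be carried back by two
columns (`Directed.eq_or_exists_carry`), which keeps the word directed and lowers the sum of the
distances of these letters from the first column (`weight_carry_lt`). The reverse step is a single
basic move (`carry_basicMove`), decided by the letters in the column jumped over. If there are none,
it is a castling. If they have the sign of the carried letter, it is a detowering in which the
raised letter `a` is the next one. If they have the opposite sign, then `k` and `k + m` have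
opposite signs, the polyline is monotone, and each part of the rectangle is a single Young diagram
over its full width; the step is a clipping of two squares in adjacent columns
(`clipping_of_isMonotoneRep`). Induction on the weight concludes.
-/

namespace CK

/-! ### Elements of `cK` as triples of exponent sums -/

/-- The exponent sums of a word: of its letters `b^{±1}` at even abscissae, of its letters `b^{±1}`
at odd abscissae, and of its letters `a^{±1}`. A leading `a^{±1}` changes the parity of all
abscissae after it and so swaps the first two sums. -/
def expSums : List Letter → ℤ × ℤ × ℤ
  | [] => (0, 0, 0)
  | (Gen.a, s) :: L => ((expSums L).2.1, (expSums L).1, (expSums L).2.2 + sgn s)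
  | (Gen.b, s) :: L => ((expSums L).1 + sgn s, (expSums L).2.1, (expSums L).2.2)

/-- Left multiplication by `a` on triples of exponent sums. -/
def permA : Equiv.Perm (ℤ × ℤ × ℤ) where
  toFun p := (p.2.1, p.1, p.2.2 + 1)
  invFun p := (p.2.1, p.1, p.2.2 - 1)
  left_inv p := by simp
  right_inv p := by simp

/-- Left multiplication by `b` on triples of exponent sums. -/
def permB : Equiv.Perm (ℤ × ℤ × ℤ) where
  toFun p := (p.1 + 1, p.2.1, p.2.2)
  invFun p := (p.1 - 1, p.2.1, p.2.2)
  left_inv p := by simp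
  right_inv p := by simp

lemma permA_apply (p : ℤ × ℤ × ℤ) : permA p = (p.2.1, p.1, p.2.2 + 1) := rfl
lemma permA_inv_apply (p : ℤ × ℤ × ℤ) : permA⁻¹ p = (p.2.1, p.1, p.2.2 - 1) := rfl
lemma permB_apply (p : ℤ × ℤ × ℤ) : permB p = (p.1 + 1, p.2.1, p.2.2) := rfl
lemma permB_inv_apply (p : ℤ × ℤ × ℤ) : permB⁻¹ p = (p.1 - 1, p.2.1, p.2.2) := rfl

def genPerm : Gen → Equiv.Perm (ℤ × ℤ × ℤ)
  | Gen.a => permA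
  | Gen.b => permB

lemma lift_genPerm_rel : ∀ r ∈ ({ft * fa * ft⁻¹ * fa⁻¹, fb * ft * fb⁻¹ * ft⁻¹} :
    Set (FreeGroup Gen)), FreeGroup.lift genPerm r = 1 := by
  rintro r (rfl | rfl) <;>
  · simp only [ft, fa, fb, map_mul, map_inv, FreeGroup.lift_apply_of, genPerm, mul_inv_rev, inv_inv]
    ext p <;>
    simp [Equiv.Perm.mul_apply, permA_apply, permB_apply, permA_inv_apply, permB_inv_apply,
      -Equiv.Perm.coe_inv]

/-- The action of `cK` on triples of exponent sums. -/
def action : cK →* Equiv.Perm (ℤ × ℤ × ℤ) := PresentedGroup.toGroup lift_genPerm_rel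

lemma action_toCK (w : FreeGroup Gen) : action (toCK w) = FreeGroup.lift genPerm w := rfl

lemma lift_genPerm_mk (L : List Letter) :
    FreeGroup.lift genPerm (FreeGroup.mk L) (0, 0, 0) = expSums L := by
  rw [FreeGroup.lift_mk]
  induction L with
  | nil => rfl
  | cons x L ih =>
    rw [List.map_cons, List.prod_cons, Equiv.Perm.mul_apply, ih]
    rcases x with ⟨_ | _, _ | _⟩ <;>
      simp [genPerm, expSums, sgn, permA_apply, permB_apply, permA_inv_apply, permB_inv_apply,
        sub_eq_add_neg, -Equiv.Perm.coe_inv]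

lemma permA_zpow_apply (n : ℤ) : ∀ r, (permA ^ n) (0, 0, r) = (0, 0, r + n) := by
  induction n with
  | zero => simp
  | succ i ih => intro r; rw [zpow_add_one, Equiv.Perm.mul_apply, permA_apply, ih]; ring_nf
  | pred i ih => intro r; rw [zpow_sub_one, Equiv.Perm.mul_apply, permA_inv_apply, ih]; ring_nf

lemma permB_zpow_apply (n : ℤ) : ∀ p q r, (permB ^ n) (p, q, r) = (p + n, q, r) := by
  induction n with
  | zero => simp
  | succ i ih => intro p q r; rw [zpow_add_one, Equiv.Perm.mul_apply, permB_apply, ih]; ring_nf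
  | pred i ih => intro p q r; rw [zpow_sub_one, Equiv.Perm.mul_apply, permB_inv_apply, ih]; ring_nf

lemma lift_genPerm_ft_apply (p : ℤ × ℤ × ℤ) :
    FreeGroup.lift genPerm ft p = (p.1 + 1, p.2.1 + 1, p.2.2) := by
  simp [ft, fa, fb, genPerm, permA_apply, permB_apply, permA_inv_apply, -Equiv.Perm.coe_inv]

lemma lift_genPerm_ft_zpow_apply (n : ℤ) :
    ∀ p q r, ((FreeGroup.lift genPerm ft) ^ n) (p, q, r) = (p + n, q + n, r) := by
  have hinv : ∀ p : ℤ × ℤ × ℤ,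
      (FreeGroup.lift genPerm ft)⁻¹ p = (p.1 - 1, p.2.1 - 1, p.2.2) := by
    intro p
    rw [Equiv.Perm.inv_eq_iff_eq, lift_genPerm_ft_apply]
    simp
  induction n with
  | zero => simp
  | succ i ih =>
    intro p q r; rw [zpow_add_one, Equiv.Perm.mul_apply, lift_genPerm_ft_apply, ih]; ring_nf
  | pred i ih => intro p q r; rw [zpow_sub_one, Equiv.Perm.mul_apply, hinv, ih]; ring_nf

lemma action_elt (k m n : ℤ) : action (elt k m n) (0, 0, 0) = (k + m, k, n) := by
  rw [elt, map_mul, map_mul, map_zpow, map_zpow, map_zpow, action_toCK, action_toCK, action_toCK]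
  have ha : FreeGroup.lift genPerm fa = permA := FreeGroup.lift_apply_of
  have hb : FreeGroup.lift genPerm fb = permB := FreeGroup.lift_apply_of
  rw [ha, hb, Equiv.Perm.mul_apply, Equiv.Perm.mul_apply, permA_zpow_apply, permB_zpow_apply,
    lift_genPerm_ft_zpow_apply]
  ring_nf

lemma commute_ft_fa : Commute (toCK ft) (toCK fa) := by
  have h : toCK (ft * fa * ft⁻¹ * fa⁻¹) = 1 := PresentedGroup.one_of_mem (by simp)
  rw [map_mul, map_mul, map_mul, map_inv, map_inv] at h
  exact eq_of_mul_inv_eq_one (by rw [← h]; group)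

lemma commute_ft_fb : Commute (toCK ft) (toCK fb) := by
  have h : toCK (fb * ft * fb⁻¹ * ft⁻¹) = 1 := PresentedGroup.one_of_mem (by simp)
  rw [map_mul, map_mul, map_mul, map_inv, map_inv] at h
  exact (eq_of_mul_inv_eq_one (by rw [← h]; group) : Commute (toCK fb) (toCK ft)).symm

/-- Conjugation by `a` sends `b` to `t b⁻¹`. -/
lemma conj_fb : toCK fa * toCK fb * (toCK fa)⁻¹ = toCK ft * (toCK fb)⁻¹ := by
  simp [ft]

lemma conj_fb_zpow (m : ℤ) :
    toCK fa * toCK fb ^ m * (toCK fa)⁻¹ = toCK ft ^ m * toCK fb ^ (-m) := by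
  rw [← conj_zpow, conj_fb, (commute_ft_fb.inv_right).mul_zpow, inv_zpow, zpow_neg]

lemma fa_mul_elt (k m n : ℤ) : toCK fa * elt k m n = elt (k + m) (-m) (n + 1) := by
  have h := conj_fb_zpow m
  rw [mul_inv_eq_iff_eq_mul] at h
  have h2 := (commute_ft_fa.zpow_left k).eq
  calc toCK fa * elt k m n
      = (toCK fa * toCK ft ^ k) * toCK fb ^ m * toCK fa ^ n := by simp only [elt, mul_assoc]
    _ = toCK ft ^ k * (toCK fa * toCK fb ^ m) * toCK fa ^ n := by rw [← h2]; simp only [mul_assoc]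
    _ = elt (k + m) (-m) (n + 1) := by
        rw [h, elt, zpow_add, add_comm n 1, zpow_add, zpow_one]; simp only [mul_assoc]

lemma fa_inv_mul_elt (k m n : ℤ) : (toCK fa)⁻¹ * elt k m n = elt (k + m) (-m) (n - 1) := by
  rw [inv_mul_eq_iff_eq_mul, fa_mul_elt]
  congr 1 <;> ring

lemma fb_zpow_mul_elt (j k m n : ℤ) : toCK fb ^ j * elt k m n = elt k (m + j) n := by
  have h2 := ((commute_ft_fb.zpow_left k).zpow_right j).eq
  rw [elt, ← mul_assoc, ← mul_assoc, ← h2, elt, add_comm m j, zpow_add]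
  simp only [mul_assoc]

lemma toCK_mk (L : List Letter) :
    toCK (FreeGroup.mk L) =
      elt (expSums L).2.1 ((expSums L).1 - (expSums L).2.1) (expSums L).2.2 := by
  induction L with
  | nil => simp [expSums, elt, ← FreeGroup.one_eq_mk]
  | cons x L ih =>
    rw [← List.singleton_append, ← FreeGroup.mul_mk, map_mul, ih]
    rcases x with ⟨_ | _, _ | _⟩
    · have : FreeGroup.mk [(Gen.a, false)] = fa⁻¹ := rfl
      rw [this, map_inv, fa_inv_mul_elt]
      simp [expSums, sgn, sub_eq_add_neg]
    · have : FreeGroup.mk [(Gen.a, true)] = fa := rfl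
      rw [this, fa_mul_elt]
      simp [expSums, sgn]
    · have : FreeGroup.mk [(Gen.b, false)] = fb⁻¹ := rfl
      rw [this, map_inv, ← zpow_neg_one (toCK fb), fb_zpow_mul_elt]
      simp only [expSums, sgn, List.cons_append, List.nil_append]
      congr 1; simp; ring
    · have : FreeGroup.mk [(Gen.b, true)] = fb := rfl
      rw [this, ← zpow_one (toCK fb), fb_zpow_mul_elt]
      simp only [expSums, sgn, List.cons_append, List.nil_append]
      congr 1; simp; ring

/-- The exponent sums are a complete invariant of the element of `cK` that a word represents. -/
lemma toCK_mk_eq_elt_iff (L : List Letter) (k m n : ℤ) :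
    toCK (FreeGroup.mk L) = elt k m n ↔ expSums L = (k + m, k, n) := by
  constructor
  · intro h
    rw [← lift_genPerm_mk, ← action_toCK, h, action_elt]
  · intro h
    rw [toCK_mk, h]
    simp

/-! ### Directed words -/

/-- The number of letters `a^{±1}`. -/
def numA (L : List Letter) : ℕ := (L.map Prod.fst).count Gen.a

/-- The number of letters `b^{±1}`. -/
def numB (L : List Letter) : ℕ := (L.map Prod.fst).count Gen.b

section

variable (s : Bool) (i : ℕ) (L L' : List Letter)

@[simp] lemma numA_nil : numA [] = 0 := rfl
@[simp] lemma numB_nil : numB [] = 0 := rfl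
@[simp] lemma numA_cons_a : numA ((Gen.a, s) :: L) = numA L + 1 := by simp [numA]
@[simp] lemma numA_cons_b : numA ((Gen.b, s) :: L) = numA L := by simp [numA]
@[simp] lemma numB_cons_a : numB ((Gen.a, s) :: L) = numB L := by simp [numB]
@[simp] lemma numB_cons_b : numB ((Gen.b, s) :: L) = numB L + 1 := by simp [numB]
@[simp] lemma numA_append : numA (L ++ L') = numA L + numA L' := by simp [numA]
@[simp] lemma numB_append : numB (L ++ L') = numB L + numB L' := by simp [numB]
@[simp] lemma numA_replicate_b : numA (List.replicate i (Gen.b, s)) = 0 := by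
  simp [numA, List.count_replicate]
@[simp] lemma numB_replicate_b : numB (List.replicate i (Gen.b, s)) = i := by simp [numB]

end

lemma numA_add_numB (L : List Letter) : numA L + numB L = L.length := by
  induction L with
  | nil => rfl
  | cons x L ih => rcases x with ⟨_ | _, t⟩ <;> simp <;> omega

/-- All letters `a^{±1}` have the sign `s`, the letters `b^{±1}` at even abscissae the sign `e`, and
those at odd abscissae the sign `f`. -/
def Directed (s : Bool) : Bool → Bool → List Letter → Prop
  | _, _, [] => True
  | e, f, (Gen.a, t) :: L => t = s ∧ Directed s f e L
  | e, f, (Gen.b, t) :: L => t = e ∧ Directed s e f L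

@[simp] lemma sgn_mul_sgn (s : Bool) : sgn s * sgn s = 1 := by cases s <;> rfl

lemma sgn_mul_sgn_of_ne {s t : Bool} (h : t ≠ s) : sgn s * sgn t = -1 := by
  cases s <;> cases t <;> simp_all [sgn]

lemma expSums_le_length (s : Bool) (L : List Letter) : ∀ e f,
    sgn e * (expSums L).1 + sgn f * (expSums L).2.1 + sgn s * (expSums L).2.2 ≤ L.length := by
  induction L with
  | nil => simp [expSums]
  | cons x L ih =>
    intro e f
    have := ih e f
    have := ih f e
    rcases x with ⟨_ | _, t⟩ <;> cases s <;> cases e <;> cases f <;> cases t <;>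
      simp [expSums, sgn] at * <;> linarith

/-- The equality case of `expSums_le_length`. -/
lemma directed_of_length_le (s : Bool) (L : List Letter) : ∀ e f,
    (L.length : ℤ) ≤
      sgn e * (expSums L).1 + sgn f * (expSums L).2.1 + sgn s * (expSums L).2.2 →
    Directed s e f L := by
  induction L with
  | nil => simp [Directed]
  | cons x L ih =>
    rcases x with ⟨_ | _, t⟩ <;> intro e f h
    · have h1 := expSums_le_length s L f e
      simp only [expSums, List.length_cons] at h
      by_cases hts : t = s
      · subst hts
        refine ⟨rfl, ih f e ?_⟩
        rw [mul_add, sgn_mul_sgn] at h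
        push_cast at h; linarith
      · rw [mul_add, sgn_mul_sgn_of_ne hts] at h
        push_cast at h; linarith
    · have h1 := expSums_le_length s L e f
      simp only [expSums, List.length_cons] at h
      by_cases hte : t = e
      · subst hte
        refine ⟨rfl, ih t f ?_⟩
        rw [mul_add, sgn_mul_sgn] at h
        push_cast at h; linarith
      · rw [mul_add, sgn_mul_sgn_of_ne hte] at h
        push_cast at h; linarith

namespace Directed

variable {s e f : Bool} {L : List Letter}

lemma sgn_mul_expSums (h : Directed s e f L) :
    0 ≤ sgn e * (expSums L).1 ∧ 0 ≤ sgn f * (expSums L).2.1 ∧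
      sgn e * (expSums L).1 + sgn f * (expSums L).2.1 = numB L ∧
      sgn s * (expSums L).2.2 = numA L := by
  induction L generalizing e f with
  | nil => simp [expSums]
  | cons x L ih =>
    rcases x with ⟨_ | _, t⟩ <;> obtain ⟨rfl, h⟩ := h <;> obtain ⟨h1, h2, h3, h4⟩ := ih h <;>
      simp [expSums, mul_add] <;> refine ⟨?_, ?_, ?_, ?_⟩ <;> linarith

lemma isReduced (h : Directed s e f L) : FreeGroup.IsReduced L := by
  induction L generalizing e f with
  | nil => exact FreeGroup.IsReduced.nil
  | cons x L ih =>
    cases L with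
    | nil => exact FreeGroup.IsReduced.singleton
    | cons y L =>
      refine List.isChain_cons_cons.2 ⟨?_, ?_⟩
      · rcases x with ⟨_ | _, t⟩ <;> rcases y with ⟨_ | _, t'⟩ <;> simp_all [Directed]
      · rcases x with ⟨_ | _, t⟩ <;> exact ih h.2

lemma toWord_mk (h : Directed s e f L) : (FreeGroup.mk L).toWord = L := by
  rw [FreeGroup.toWord_mk, h.isReduced.reduce_eq]

lemma isGeodesicRep (h : Directed s e f L) {k m n : ℤ} (hL : expSums L = (k + m, k, n)) :
    IsGeodesicRep (FreeGroup.mk L) (elt k m n) := by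
  refine ⟨(toCK_mk_eq_elt_iff L k m n).2 hL, fun v hv => ?_⟩
  rw [← FreeGroup.mk_toWord (x := v), toCK_mk_eq_elt_iff, ← hL] at hv
  obtain ⟨-, -, h1, h2⟩ := h.sgn_mul_expSums
  have h3 := expSums_le_length s v.toWord e f
  rw [hv] at h3
  have h4 : numA L + numB L = L.length := numA_add_numB L
  have h5 : (FreeGroup.mk L).norm ≤ L.length := FreeGroup.norm_mk_le
  have h6 : v.norm = v.toWord.length := rfl
  omega

end Directed

lemma IsGeodesicRep.expSums_toWord {w : FreeGroup Gen} {k m n : ℤ}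
    (hw : IsGeodesicRep w (elt k m n)) : expSums w.toWord = (k + m, k, n) := by
  rw [← toCK_mk_eq_elt_iff, FreeGroup.mk_toWord, hw.1]

/-- A geodesic is as long as any directed word for the same element, and then the equality case of
the length bound makes it directed too. -/
lemma IsGeodesicRep.directed {w : FreeGroup Gen} {s e f : Bool} {L : List Letter} {k m n : ℤ}
    (hw : IsGeodesicRep w (elt k m n)) (h : Directed s e f L)
    (hL : expSums L = (k + m, k, n)) : Directed s e f w.toWord := by
  apply directed_of_length_le
  have h1 := hw.2 _ (h.isGeodesicRep hL).1
  have h2 : (FreeGroup.mk L).norm ≤ L.length := FreeGroup.norm_mk_le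
  have h3 : w.norm = w.toWord.length := rfl
  have h4 := h.sgn_mul_expSums
  have h5 : numA L + numB L = L.length := numA_add_numB L
  rw [hw.expSums_toWord, ← hL]
  omega

/-! ### The polyline of a monotone word -/

lemma Directed.of_append {s e f : Bool} {u v : List Letter} (h : Directed s e f (u ++ v)) :
    Directed s e f u := by
  induction u generalizing e f with
  | nil => trivial
  | cons x u ih => rcases x with ⟨_ | _, t⟩ <;> exact ⟨h.1, ih h.2⟩

/-- If the signs of `b` at even and odd abscissae are opposite, then all letters `b^{±1}` are drawn
in the same vertical direction. -/
lemma Directed.foldl_step {s e : Bool} {L : List Letter} : ∀ {x y : ℤ},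
    Directed s (if Even x then e else !e) (if Even x then !e else e) L →
      L.foldl step (x, y) = (x + sgn s * numA L, y + sgn e * numB L) := by
  induction L with
  | nil => simp
  | cons l L ih =>
    intro x y h
    rcases l with ⟨_ | _, t⟩
    · obtain ⟨rfl, h⟩ := h
      have hx : Even (x + sgn t) ↔ ¬ Even x := by
        cases t <;> simp [sgn, parity_simps]
      rw [List.foldl_cons, step, ih]
      · simp; ring
      · by_cases h2 : Even x <;> simp only [hx, h2] <;> simpa [h2] using h
    · obtain ⟨rfl, h⟩ := h
      have hy : (if Even x then y + sgn (if Even x then e else !e)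
          else y - sgn (if Even x then e else !e)) = y + sgn e := by
        by_cases h2 : Even x <;> simp [h2]
        cases e <;> simp [sgn, sub_eq_add_neg]
      rw [List.foldl_cons, step, hy, ih h]
      simp; ring

lemma Directed.endpoint_eq {s e : Bool} {L : List Letter} (h : Directed s e (!e) L) :
    endpoint L = (sgn s * numA L, sgn e * numB L) := by
  rw [endpoint, Directed.foldl_step (s := s) (e := e)] <;> simp [h]

/-- The number of letters `b^{±1}` before the `i`-th letter `a^{±1}`, counted from `0`. -/
def height : List Letter → ℕ → ℕ
  | [], _ => 0
  | (Gen.a, _) :: _, 0 => 0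
  | (Gen.a, _) :: L, i + 1 => height L i
  | (Gen.b, _) :: L, i => height L i + 1

lemma height_append (u v : List Letter) (i : ℕ) :
    height (u ++ v) i = if i < numA u then height u i else numB u + height v (i - numA u) := by
  induction u generalizing i with
  | nil => simp
  | cons l u ih =>
    rcases l with ⟨_ | _, t⟩
    · cases i with
      | zero => simp [height]
      | succ i => simp [height, ih]
    · simp only [List.cons_append, height, ih, numA_cons_b, numB_cons_b]
      split_ifs <;> omega

lemma monotone_height (L : List Letter) : Monotone (height L) := by
  induction L with
  | nil => exact fun _ _ _ => le_rfl
  | cons l L ih =>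
    intro i j hij
    rcases l with ⟨_ | _, t⟩
    · cases i with
      | zero => simp [height]
      | succ i =>
        cases j with
        | zero => omega
        | succ j => exact ih (by omega)
    · exact Nat.add_le_add_right (ih hij) 1

lemma height_le (L : List Letter) (i : ℕ) : height L i ≤ numB L := by
  induction L generalizing i with
  | nil => simp [height]
  | cons l L ih =>
    rcases l with ⟨_ | _, t⟩
    · cases i with
      | zero => simp [height]
      | succ i => simpa [height] using ih i
    · simpa [height] using ih i

lemma Directed.exists_eq_append {s e f : Bool} {L : List Letter} (h : Directed s e f L) {i : ℕ}
    (hi : i < numA L) : ∃ u v, L = u ++ aLetter s :: v ∧ numA u = i := by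
  induction L generalizing e f i with
  | nil => simp at hi
  | cons l L ih =>
    rcases l with ⟨_ | _, t⟩
    · obtain ⟨rfl, h⟩ := h
      cases i with
      | zero => exact ⟨[], L, rfl, rfl⟩
      | succ i =>
        obtain ⟨u, v, rfl, hu⟩ := ih h (i := i) (by simpa using hi)
        exact ⟨aLetter t :: u, v, rfl, by simp [hu]⟩
    · obtain ⟨u, v, rfl, hu⟩ := ih h.2 (i := i) (by simpa using hi)
      exact ⟨(Gen.b, t) :: u, v, rfl, by simp [hu]⟩

/-- The left end of the `i`-th unit interval of the half-line from `0` in the direction of `s`. -/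
def slot (s : Bool) (i : ℕ) : ℤ := if s then i else -i - 1

lemma slot_injective (s : Bool) : Function.Injective (slot s) := by
  intro i j h
  cases s <;> simp [slot] at h <;> exact h

lemma Directed.hasEdge_iff {s e : Bool} {L : List Letter} (hL : Directed s e (!e) L) {x h : ℤ} :
    HasEdge L (x, h) (x + 1, h) ↔ ∃ i < numA L, x = slot s i ∧ h = sgn e * height L i := by
  constructor
  · rintro ⟨u, v, ⟨_ | _, t⟩, rfl, h'⟩
    · have h1 : Directed s e (!e) (u ++ [(Gen.a, t)]) :=
        (List.append_cons u _ v ▸ hL).of_append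
      rw [h1.endpoint_eq, h1.of_append.endpoint_eq] at h'
      refine ⟨numA u, by simp, ?_, ?_⟩
      · cases s <;> simp [sgn, slot] at h' ⊢ <;> omega
      · simp [height_append, height]
        simp at h'
        rcases h' with h' | h'
        exacts [h'.1.2.symm, h'.1.2.symm]
    · have h1 : Directed s e (!e) (u ++ [(Gen.b, t)]) :=
        (List.append_cons u _ v ▸ hL).of_append
      rw [h1.endpoint_eq, h1.of_append.endpoint_eq] at h'
      simp at h'
      omega
  · rintro ⟨i, hi, rfl, rfl⟩
    obtain ⟨u, v, rfl, rfl⟩ := hL.exists_eq_append hi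
    have h1 : Directed s e (!e) (u ++ [aLetter s]) := (List.append_cons u _ v ▸ hL).of_append
    refine ⟨u, v, aLetter s, rfl, ?_⟩
    rw [h1.endpoint_eq, h1.of_append.endpoint_eq]
    cases s
    · right; simp [sgn, slot, height_append, height]; ring
    · left; simp [sgn, slot, height_append, height]

/-! ### The two parts of the rectangle as Young diagrams -/

/-- The side of the rectangle towards which the polyline goes. -/
def ahead (e : Bool) : Side := if e then Side.above else Side.below

/-- The data of a monotone word for `(k, m, n)`: its letters `a^{±1}` have the sign `s`, and all its
letters `b^{±1}` are drawn in the vertical direction of `e`. -/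
structure IsMonotoneRep (s e : Bool) (k m n : ℤ) (L : List Letter) : Prop where
  directed : Directed s e (!e) L
  expSums_eq : expSums L = (k + m, k, n)

namespace IsMonotoneRep

variable {s e : Bool} {k m n : ℤ} {L : List Letter}

lemma eq_sgn_mul (h : IsMonotoneRep s e k m n L) : n = sgn s * numA L := by
  have h1 := h.directed.sgn_mul_expSums.2.2.2
  rw [← h1, ← mul_assoc, sgn_mul_sgn, h.expSums_eq, one_mul]

lemma bottom_top (h : IsMonotoneRep s e k m n L) :
    bottom k m = (if e then 0 else -(numB L : ℤ)) ∧ top k m = if e then (numB L : ℤ) else 0 := by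
  obtain ⟨h1, h2, h3, -⟩ := h.directed.sgn_mul_expSums
  rw [h.expSums_eq] at h1 h2 h3
  simp only [bottom, top]
  cases e <;> simp [sgn] at h1 h2 h3 ⊢ <;> omega

lemma mem_rect_iff (h : IsMonotoneRep s e k m n L) {c : Cell} :
    c ∈ rect k m n ↔ ∃ i < numA L, ∃ j < numB L, c = (slot s i, slot e j) := by
  obtain ⟨x, y⟩ := c
  simp only [rect, Set.mem_ofPred_eq, h.bottom_top.1, h.bottom_top.2, h.eq_sgn_mul, Prod.mk.injEq]
  constructor
  · rintro ⟨h1, h2, h3, h4⟩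
    refine ⟨(if s then x else -x - 1).toNat, ?_, (if e then y else -y - 1).toNat, ?_, ?_, ?_⟩ <;>
      cases s <;> cases e <;> simp [sgn, slot] at * <;> omega
  · rintro ⟨i, hi, j, hj, rfl, rfl⟩
    cases s <;> cases e <;> simp [sgn, slot] <;> omega

lemma mem_part_ahead_iff (h : IsMonotoneRep s e k m n L) {c : Cell} :
    c ∈ part k m n L (ahead e) ↔
      ∃ i < numA L, ∃ j < numB L, height L i ≤ j ∧ c = (slot s i, slot e j) := by
  have key : c ∈ part k m n L (ahead e) ↔ c ∈ rect k m n ∧ ∃ h', HasEdge L (c.1, h') (c.1 + 1, h') ∧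
      if e then h' ≤ c.2 else c.2 < h' := by
    cases e <;> rfl
  simp only [key, h.directed.hasEdge_iff, h.mem_rect_iff]
  constructor
  · rintro ⟨⟨i, hi, j, hj, rfl⟩, h', ⟨i', hi', hii', rfl⟩, h2⟩
    obtain rfl := slot_injective s hii'
    refine ⟨i, hi, j, hj, ?_, rfl⟩
    cases e <;> simp [sgn, slot] at h2 <;> omega
  · rintro ⟨i, hi, j, hj, hij, rfl⟩
    refine ⟨⟨i, hi, j, hj, rfl⟩, _, ⟨i, hi, rfl, rfl⟩, ?_⟩
    cases e <;> simp [sgn, slot] <;> omega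

lemma mem_part_behind_iff (h : IsMonotoneRep s e k m n L) {c : Cell} :
    c ∈ part k m n L (ahead !e) ↔
      ∃ i < numA L, ∃ j < numB L, j < height L i ∧ c = (slot s i, slot e j) := by
  have key : c ∈ part k m n L (ahead !e) ↔ c ∈ rect k m n ∧
      ∃ h', HasEdge L (c.1, h') (c.1 + 1, h') ∧ if e then c.2 < h' else h' ≤ c.2 := by
    cases e <;> rfl
  simp only [key, h.directed.hasEdge_iff, h.mem_rect_iff]
  constructor
  · rintro ⟨⟨i, hi, j, hj, rfl⟩, h', ⟨i', hi', hii', rfl⟩, h2⟩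
    obtain rfl := slot_injective s hii'
    refine ⟨i, hi, j, hj, ?_, rfl⟩
    cases e <;> simp [sgn, slot] at h2 <;> omega
  · rintro ⟨i, hi, j, hj, hij, rfl⟩
    refine ⟨⟨i, hi, j, hj, rfl⟩, _, ⟨i, hi, rfl, rfl⟩, ?_⟩
    cases e <;> simp [sgn, slot] <;> omega

end IsMonotoneRep

/-- The Young diagram with `N` columns of the heights `g 0 ≥ g 1 ≥ ⋯`. -/
def youngOfAntitone (N : ℕ) (g : ℕ → ℕ) (hg : Antitone g) : YoungDiagram where
  cells := (Finset.range (g 0) ×ˢ Finset.range N).filter fun c => c.1 < g c.2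
  isLowerSet := by
    rintro ⟨i, j⟩ ⟨i', j'⟩ h h1
    obtain ⟨hi, hj⟩ : i' ≤ i ∧ j' ≤ j := h
    simp only [Finset.coe_filter, Finset.mem_product, Finset.mem_range, Set.mem_ofPred_eq] at h1 ⊢
    have := hg hj
    omega

lemma mem_youngOfAntitone {N : ℕ} {g : ℕ → ℕ} {hg : Antitone g} {i j : ℕ} :
    (i, j) ∈ youngOfAntitone N g hg ↔ j < N ∧ i < g j := by
  rw [← YoungDiagram.mem_cells]
  simp only [youngOfAntitone, Finset.mem_filter, Finset.mem_product, Finset.mem_range]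
  have := hg (Nat.zero_le j)
  omega

/-- The corner is the square of the first column that is farthest from the starting side. -/
lemma IsMonotoneRep.isYoungOver_ahead {s e : Bool} {k m n : ℤ} {L : List Letter}
    (h : IsMonotoneRep s e k m n L) :
    IsYoungOver k m (ahead e) (part k m n L (ahead e)) (min 0 n) (max 0 n) s := by
  refine ⟨youngOfAntitone (numA L) (fun i => numB L - height L i)
    fun i j hij => Nat.sub_le_sub_left (monotone_height L hij) _, ?_⟩
  ext ⟨x, y⟩
  simp only [Set.mem_ofPred_eq, h.mem_part_ahead_iff, drawn, Prod.mk.injEq]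
  -- A rectangle of height zero has no last row, but then no square has to be considered either.
  have hb : baseRow k m (ahead e) = slot e (numB L - 1) ∨ numB L = 0 := by
    by_cases h0 : numB L = 0
    · exact Or.inr h0
    · left
      cases e <;> simp [baseRow, ahead, h.bottom_top.1, h.bottom_top.2, slot] <;> omega
  have hi : inward (ahead e) = - sgn e := by cases e <;> rfl
  have hn := h.eq_sgn_mul
  rw [hi]
  constructor
  · rintro ⟨⟨i, hi, j, hj, hij, rfl, rfl⟩, -, -⟩
    refine ⟨numB L - 1 - j, i, mem_youngOfAntitone.2 ⟨hi, by omega⟩, ?_, ?_⟩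
    · cases s <;> simp [slot, sgn] at hn ⊢ <;> omega
    · rw [hb.resolve_right (by omega)]
      cases e <;> simp [slot, sgn] <;> omega
  · rintro ⟨j, i, hij, rfl, rfl⟩
    obtain ⟨hi, hj⟩ := mem_youngOfAntitone.1 hij
    rw [hb.resolve_right (by omega)]
    refine ⟨⟨i, hi, numB L - 1 - j, by omega, by omega, ?_, ?_⟩, ?_, ?_⟩ <;>
    first
    | cases s <;> simp [slot, sgn] at hn ⊢ <;> omega
    | cases e <;> simp [slot, sgn] <;> omega

/-- The corner is the square of the last column on the starting side. -/
lemma IsMonotoneRep.isYoungOver_behind {s e : Bool} {k m n : ℤ} {L : List Letter}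
    (h : IsMonotoneRep s e k m n L) :
    IsYoungOver k m (ahead !e) (part k m n L (ahead !e)) (min 0 n) (max 0 n) !s := by
  refine ⟨youngOfAntitone (numA L) (fun i => height L (numA L - 1 - i))
    fun i j hij => monotone_height L (Nat.sub_le_sub_left hij _), ?_⟩
  ext ⟨x, y⟩
  simp only [Set.mem_ofPred_eq, h.mem_part_behind_iff, drawn, Prod.mk.injEq]
  have hb : baseRow k m (ahead !e) = slot e 0 := by
    cases e <;> simp [baseRow, ahead, h.bottom_top.1, h.bottom_top.2, slot]
  have hi : inward (ahead !e) = sgn e := by cases e <;> rfl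
  have hn := h.eq_sgn_mul
  rw [hi, hb]
  constructor
  · rintro ⟨⟨i, hi, j, hj, hij, rfl, rfl⟩, -, -⟩
    refine ⟨j, numA L - 1 - i, mem_youngOfAntitone.2 ⟨by omega, ?_⟩, ?_, ?_⟩
    · rwa [show numA L - 1 - (numA L - 1 - i) = i by omega]
    · cases s <;> simp [slot, sgn] at hn ⊢ <;> omega
    · cases e <;> simp [slot, sgn]
      omega
  · rintro ⟨j, i, hij, rfl, rfl⟩
    obtain ⟨hi, hj⟩ := mem_youngOfAntitone.1 hij
    have := height_le L (numA L - 1 - i)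
    refine ⟨⟨numA L - 1 - i, by omega, j, by omega, hj, ?_, ?_⟩, ?_, ?_⟩ <;>
    first
    | cases s <;> simp [slot, sgn] at hn ⊢ <;> omega
    | cases e <;> simp [slot, sgn] ; omega

lemma IsMonotoneRep.exists_isYoungOver {s e : Bool} {k m n : ℤ} (r : Side) :
    ∃ l : Bool, ∀ L, IsMonotoneRep s e k m n L →
      IsYoungOver k m r (part k m n L r) (min 0 n) (max 0 n) l := by
  by_cases hr : r = ahead e
  · subst hr
    exact ⟨s, fun L h => h.isYoungOver_ahead⟩
  · have hr : r = ahead !e := by cases r <;> cases e <;> simp_all [ahead]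
    subst hr
    exact ⟨!s, fun L h => h.isYoungOver_behind⟩

/-- Both words are monotone, so before and after the move each part of the rectangle is a Young
diagram over the full width, which is maximal for trivial reasons. Only the two squares that change
sides, in the columns `numA u` and `numA u + 1`, have to be followed. -/
lemma clipping_of_isMonotoneRep {s e e' : Bool} {k m n : ℤ} {u z : List Letter} {y : ℕ}
    (h : IsMonotoneRep s e k m n (u ++ [bLetter e', aLetter s] ++
      List.replicate y (bLetter !e') ++ [bLetter !e', aLetter s] ++ z))
    (h' : IsMonotoneRep s e k m n (u ++ [aLetter s, bLetter !e'] ++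
      List.replicate y (bLetter !e') ++ [aLetter s, bLetter e'] ++ z)) :
    Clipping k m n (u ++ [bLetter e', aLetter s] ++
        List.replicate y (bLetter !e') ++ [bLetter !e', aLetter s] ++ z)
      (u ++ [aLetter s, bLetter !e'] ++
        List.replicate y (bLetter !e') ++ [aLetter s, bLetter e'] ++ z) := by
  set w := u ++ [bLetter e', aLetter s] ++
      List.replicate y (bLetter !e') ++ [bLetter !e', aLetter s] ++ z with hw
  set w' := u ++ [aLetter s, bLetter !e'] ++
      List.replicate y (bLetter !e') ++ [aLetter s, bLetter e'] ++ z with hw'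
  have d4 := h.directed.of_append
  have d3 := d4.of_append
  have d2 := d3.of_append
  have d1 := d2.of_append
  have hc : cellBetween (endpoint u) (endpoint (u ++ [bLetter e', aLetter s])) =
      (slot s (numA u), slot e (numB u)) := by
    rw [d1.endpoint_eq, d2.endpoint_eq]
    cases s <;> cases e <;> simp [cellBetween, sgn, slot]
    all_goals omega
  have hd : cellBetween
      (endpoint (u ++ [bLetter e', aLetter s] ++ List.replicate y (bLetter !e')))
      (endpoint (u ++ [bLetter e', aLetter s] ++ List.replicate y (bLetter !e') ++
        [bLetter !e', aLetter s])) = (slot s (numA u + 1), slot e (numB u + y + 1)) := by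
    rw [d3.endpoint_eq, d4.endpoint_eq]
    cases s <;> cases e <;> simp [cellBetween, sgn, slot]
    all_goals omega
  have hA : numA w = numA u + 2 + numA z := by simp [w]; omega
  have hB : numB w = numB u + y + 2 + numB z := by simp [w]; omega
  have hA' : numA w' = numA w := by simp [w, w']
  have hB' : numB w' = numB w := by simp [w, w']
  have hcr : (slot s (numA u), slot e (numB u)) ∈ rect k m n :=
    h.mem_rect_iff.2 ⟨_, by omega, _, by omega, rfl⟩
  have hdr : (slot s (numA u + 1), slot e (numB u + y + 1)) ∈ rect k m n :=
    h.mem_rect_iff.2 ⟨_, by omega, _, by omega, rfl⟩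
  have hh : ∀ i, height w i = if i = numA u then numB u + 1 else
      if i = numA u + 1 then numB u + y + 2 else height w' i := by
    intro i
    split_ifs with h1 h2
    · simp [w, height_append, height, h1]
    · simp [w, height_append, height, h2]; omega
    · simp only [w, w', List.append_assoc, height_append u]
      split_ifs with h3
      · rfl
      · obtain ⟨t, rfl⟩ : ∃ t, i = numA u + (t + 2) := ⟨i - numA u - 2, by omega⟩
        simp [height_append, height]
  have hh' : height w' (numA u) = numB u ∧ height w' (numA u + 1) = numB u + y + 1 := by
    constructor <;> simp [w', height_append, height]; omega
  refine ⟨u, _, _, _, _, _, z, _, _, hw, hw', .ba e' s, ?_, hc.symm, hd.symm, ?_, hcr, hdr,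
    ⟨ahead e, ?_, ?_, ?_⟩, ?_⟩
  · simpa using CornerSwap.ba (!e') s
  · cases s <;> simp [slot]
  · rw [h.mem_part_ahead_iff]
    rintro ⟨i, hi, j, hj, hij, heq⟩
    obtain ⟨h1, h2⟩ := Prod.mk.inj heq
    obtain rfl := slot_injective _ h1
    obtain rfl := slot_injective _ h2
    rw [hh, if_pos rfl] at hij
    omega
  · rw [h.mem_part_ahead_iff]
    rintro ⟨i, hi, j, hj, hij, heq⟩
    obtain ⟨h1, h2⟩ := Prod.mk.inj heq
    obtain rfl := slot_injective _ h1
    obtain rfl := slot_injective _ h2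
    rw [hh, if_neg (by omega), if_pos rfl] at hij
    omega
  · ext c
    simp only [Set.mem_union, h.mem_part_ahead_iff, h'.mem_part_ahead_iff, Set.mem_insert_iff,
      Set.mem_singleton_iff, hA', hB']
    constructor
    · rintro ⟨i, hi, j, hj, hij, rfl⟩
      by_cases h1 : height w i ≤ j
      · exact Or.inl ⟨i, hi, j, hj, h1, rfl⟩
      · right
        rw [hh] at h1
        split_ifs at h1 with h2 h3
        · subst h2
          rw [hh'.1] at hij
          rw [show j = numB u by omega]
          exact Or.inl rfl
        · subst h3
          rw [hh'.2] at hij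
          rw [show j = numB u + y + 1 by omega]
          exact Or.inr rfl
        · omega
    · rintro (⟨i, hi, j, hj, hij, rfl⟩ | rfl | rfl)
      · refine ⟨i, hi, j, hj, ?_, rfl⟩
        rw [hh] at hij
        split_ifs at hij with h2 h3
        · subst h2
          rw [hh'.1]; omega
        · subst h3
          rw [hh'.2]; omega
        · exact hij
      · exact ⟨_, by omega, _, by omega, hh'.1.le, rfl⟩
      · exact ⟨_, by omega, _, by omega, hh'.2.le, rfl⟩
  · intro r g hg
    have hgr : g ∈ rect k m n := by rcases hg with rfl | rfl <;> assumption
    obtain ⟨l, hl⟩ := IsMonotoneRep.exists_isYoungOver (s := s) (e := e) (k := k) (m := m) (n := n) r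
    refine ⟨min 0 n, max 0 n, l, hgr.1, hgr.2.1, ⟨le_rfl, hgr.1.trans_lt hgr.2.1, le_rfl, hl w h, ?_⟩,
      hl w' h'⟩
    intro p' q' l' h1 h2 h3 h4 _
    exact ⟨le_antisymm h2 h1, le_antisymm h4 h3⟩

/-! ### Moving letters `b` towards the origin -/

/-- The sum of the distances of the letters `b^{±1}` from the column at which a directed word
starts. -/
def weight : List Letter → ℕ
  | [] => 0
  | (Gen.a, _) :: L => weight L + numB L
  | (Gen.b, _) :: L => weight L

lemma weight_append (u v : List Letter) : weight (u ++ v) = weight u + weight v + numA u * numB v := by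
  induction u with
  | nil => simp [weight]
  | cons x u ih =>
    rcases x with ⟨_ | _, t⟩
    · simp [weight, ih]; ring
    · simp [weight, ih]

@[simp] lemma directed_replicate_append {s e f : Bool} {L : List Letter} (i : ℕ) :
    Directed s e f (List.replicate i (Gen.b, e) ++ L) ↔ Directed s e f L := by
  induction i with
  | zero => simp
  | succ i ih => simp [List.replicate_succ, Directed, ih]

@[simp] lemma expSums_replicate_append (e : Bool) (L : List Letter) (i : ℕ) :
    expSums (List.replicate i (Gen.b, e) ++ L) =
      (sgn e * i + (expSums L).1, (expSums L).2.1, (expSums L).2.2) := by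
  induction i with
  | zero => simp
  | succ i ih =>
    simp only [List.replicate_succ, List.cons_append, expSums, ih]
    push_cast
    ring_nf

@[simp] lemma expSums_replicate_a (s : Bool) (i : ℕ) :
    expSums (List.replicate i (Gen.a, s)) = (0, 0, sgn s * i) := by
  induction i with
  | zero => simp [expSums]
  | succ i ih =>
    simp only [List.replicate_succ, expSums, ih]
    push_cast
    ring_nf

@[simp] lemma directed_replicate_a (s e f : Bool) (i : ℕ) :
    Directed s e f (List.replicate i (Gen.a, s)) := by
  induction i generalizing e f with
  | zero => trivial
  | succ i ih => exact ⟨rfl, ih f e⟩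

/-- A directed word has at most one nonzero power of `b` at even and one at odd abscissae, both as
early as possible, unless some letter `b^{±1}` can be carried back over two letters `a^{±1}`. The
carried letter keeps its sign, since the parity of its abscissa is kept. -/
lemma Directed.eq_or_exists_carry {s e f : Bool} {L : List Letter} (h : Directed s e f L) :
    (∃ i, L = List.replicate i (bLetter e)) ∨
    (∃ i j r, L = List.replicate i (bLetter e) ++
      aLetter s :: (List.replicate j (bLetter f) ++ List.replicate r (aLetter s))) ∨
    ∃ u z y e' f', (e' = e ∧ f' = f ∨ e' = f ∧ f' = e) ∧
      L = u ++ ([aLetter s] ++ List.replicate y (bLetter f') ++ [aLetter s, bLetter e']) ++ z ∧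
      Directed s e f
        (u ++ ([bLetter e', aLetter s] ++ List.replicate y (bLetter f') ++ [aLetter s]) ++ z) ∧
      expSums (u ++ ([bLetter e', aLetter s] ++ List.replicate y (bLetter f') ++ [aLetter s]) ++ z)
        = expSums L := by
  induction L generalizing e f with
  | nil => exact Or.inl ⟨0, rfl⟩
  | cons x L ih =>
    rcases x with ⟨_ | _, t⟩ <;> obtain ⟨rfl, h⟩ := h
    · obtain ⟨i, rfl⟩ | ⟨i, j, r, rfl⟩ | ⟨u, z, y, e', f', hef, rfl, h2, h3⟩ := ih h
      · exact Or.inr (Or.inl ⟨0, i, 0, by simp⟩)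
      · cases j with
        | zero =>
          exact Or.inr (Or.inl ⟨0, i, r + 1, by simp [List.replicate_succ]⟩)
        | succ j =>
          right; right
          refine ⟨[], List.replicate j (bLetter e) ++ List.replicate r (aLetter t), i, e, f,
            Or.inl ⟨rfl, rfl⟩, by simp [List.replicate_succ], ?_, ?_⟩
          · simp [Directed]
          · simp [List.replicate_succ, expSums]
      · right; right
        refine ⟨aLetter t :: u, z, y, e', f', hef.symm, by simp, ⟨rfl, h2⟩, ?_⟩
        simp only [List.cons_append, expSums] at h3 ⊢
        rw [h3]
    · obtain ⟨i, rfl⟩ | ⟨i, j, r, rfl⟩ | ⟨u, z, y, e', f', hef, rfl, h2, h3⟩ := ih h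
      · exact Or.inl ⟨i + 1, by simp [List.replicate_succ]⟩
      · exact Or.inr (Or.inl ⟨i + 1, j, r, by simp [List.replicate_succ]⟩)
      · right; right
        refine ⟨bLetter t :: u, z, y, e', f', hef, by simp, ⟨rfl, h2⟩, ?_⟩
        simp only [List.cons_append, expSums] at h3 ⊢
        rw [h3]

lemma weight_carry_lt (u z : List Letter) (y : ℕ) (s e f : Bool) :
    weight (u ++ ([bLetter e, aLetter s] ++ List.replicate y (bLetter f) ++ [aLetter s]) ++ z) <
      weight
        (u ++ ([aLetter s] ++ List.replicate y (bLetter f) ++ [aLetter s, bLetter e]) ++ z) := by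
  simp [weight_append, weight]
  ring_nf
  omega

/-- Carrying a letter `b^{±1}` over two letters `a^{±1}` is one basic move: castling if there are no
letters in between, and otherwise detowering or clipping according to whether the letters in
between have the same sign or the opposite sign. -/
lemma carry_basicMove {s e f e' f' : Bool} {k m n : ℤ} {u z : List Letter} {y : ℕ}
    (hef : e' = e ∧ f' = f ∨ e' = f ∧ f' = e)
    (h : Directed s e f
      (u ++ ([bLetter e', aLetter s] ++ List.replicate y (bLetter f') ++ [aLetter s]) ++ z))
    (hk : expSums
      (u ++ ([bLetter e', aLetter s] ++ List.replicate y (bLetter f') ++ [aLetter s]) ++ z) =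
        (k + m, k, n))
    (h' : Directed s e f
      (u ++ ([aLetter s] ++ List.replicate y (bLetter f') ++ [aLetter s, bLetter e']) ++ z))
    (hk' : expSums
      (u ++ ([aLetter s] ++ List.replicate y (bLetter f') ++ [aLetter s, bLetter e']) ++ z) =
        (k + m, k, n)) :
    BasicMove k m n
      (FreeGroup.mk
        (u ++ ([bLetter e', aLetter s] ++ List.replicate y (bLetter f') ++ [aLetter s]) ++ z))
      (FreeGroup.mk
        (u ++ ([aLetter s] ++ List.replicate y (bLetter f') ++ [aLetter s, bLetter e']) ++ z)) := by
  refine ⟨h.isGeodesicRep hk, ?_⟩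
  rw [h.toWord_mk, h'.toWord_mk]
  cases y with
  | zero => exact Or.inl (Castling.right u z e' s)
  | succ y =>
    right
    by_cases hf : f' = e'
    · subst hf
      left
      have := Detowering.right u (List.replicate y (bLetter f')) z 0 f' s s
      convert this using 1
      · simp [tower, List.replicate_succ]
      · simp [tower, List.replicate_succ']
    · right
      obtain rfl : f' = !e' := by cases f' <;> cases e' <;> simp_all
      obtain rfl : f = !e := by rcases hef with ⟨rfl, rfl⟩ | ⟨rfl, h2⟩ <;> simp_all
      have hy : u ++ ([bLetter e', aLetter s] ++ List.replicate (y + 1) (bLetter !e') ++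
          [aLetter s]) ++ z = u ++ [bLetter e', aLetter s] ++ List.replicate y (bLetter !e') ++
            [bLetter !e', aLetter s] ++ z := by
        simp [List.replicate_succ']
      have hy' : u ++ ([aLetter s] ++ List.replicate (y + 1) (bLetter !e') ++
          [aLetter s, bLetter e']) ++ z = u ++ [aLetter s, bLetter !e'] ++
            List.replicate y (bLetter !e') ++ [aLetter s, bLetter e'] ++ z := by
        simp [List.replicate_succ]
      rw [hy] at h hk ⊢
      rw [hy'] at h' hk' ⊢
      exact clipping_of_isMonotoneRep ⟨h, hk⟩ ⟨h', hk'⟩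

/-! ### The standard representative -/

lemma mk_replicate (x : Gen) (e : Bool) (i : ℕ) :
    FreeGroup.mk (List.replicate i (x, e)) = FreeGroup.of x ^ (sgn e * i) := by
  induction i with
  | zero => simp [FreeGroup.one_eq_mk]
  | succ i ih =>
    rw [List.replicate_succ, ← List.singleton_append, ← FreeGroup.mul_mk, ih]
    have : FreeGroup.mk [(x, e)] = FreeGroup.of x ^ sgn e := by
      cases e
      · simp [sgn, FreeGroup.of, FreeGroup.inv_mk, FreeGroup.invRev]
      · simp [sgn, FreeGroup.of]
    rw [this, ← zpow_add]
    push_cast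
    ring_nf

lemma mk_eq_standard (s e f : Bool) (i j r : ℕ) (k m n : ℤ)
    (h : expSums (List.replicate i (bLetter e) ++
      aLetter s :: (List.replicate j (bLetter f) ++ List.replicate r (aLetter s))) =
        (k + m, k, n)) :
    FreeGroup.mk (List.replicate i (bLetter e) ++
      aLetter s :: (List.replicate j (bLetter f) ++ List.replicate r (aLetter s))) =
        standard k m n := by
  simp [expSums] at h
  obtain ⟨h1, h2, h3⟩ := h
  rw [← List.singleton_append, ← FreeGroup.mul_mk, ← FreeGroup.mul_mk, ← FreeGroup.mul_mk,
    mk_replicate, mk_replicate, mk_replicate, h1, h2, standard]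
  have : FreeGroup.mk [aLetter s] = fa ^ sgn s := by
    simpa [fa] using mk_replicate Gen.a s 1
  rw [this]
  cases s
  · have hn : ¬ 0 ≤ n := by simp [sgn] at h3; omega
    have hr : sgn false * r = n + 1 := by rw [← h3]; simp [sgn]
    rw [if_neg hn, hr]
    simp [sgn, fa, fb, mul_assoc]
  · have hn : 0 ≤ n := by simp [sgn] at h3; omega
    have hr : sgn true * r = n - 1 := by rw [← h3]; simp [sgn]
    rw [if_pos hn, hr]
    simp [sgn, fa, fb, mul_assoc]

lemma exists_sgn_mul (z : ℤ) : ∃ (e : Bool) (i : ℕ), z = sgn e * i := by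
  obtain ⟨i, rfl | rfl⟩ := z.eq_nat_or_neg
  exacts [⟨true, i, by simp [sgn]⟩, ⟨false, i, by simp [sgn]⟩]

lemma exists_directed_standard (k m n : ℤ) (h : n ≠ 0 ∨ k = 0) :
    ∃ s e f L, Directed s e f L ∧ expSums L = (k + m, k, n) ∧ FreeGroup.mk L = standard k m n := by
  obtain ⟨e, i, hi⟩ := exists_sgn_mul (k + m)
  obtain ⟨f, j, hj⟩ := exists_sgn_mul k
  obtain ⟨s, r, hr⟩ := exists_sgn_mul n
  cases r with
  | zero =>
    obtain rfl : n = 0 := by simpa using hr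
    obtain rfl : k = 0 := by simpa using h
    have h1 := expSums_replicate_append e [] i
    have h2 := directed_replicate_append (s := true) (e := e) (f := true) (L := []) i
    rw [List.append_nil] at h1 h2
    refine ⟨true, e, true, List.replicate i (bLetter e), h2.2 trivial, ?_, ?_⟩
    · rw [h1, hi]; simp [expSums]
    · rw [mk_replicate, standard, hi]; simp [fb]
  | succ r =>
    have hS : expSums (List.replicate i (bLetter e) ++
      aLetter s :: (List.replicate j (bLetter f) ++ List.replicate r (aLetter s))) =
        (k + m, k, n) := by
      simp [expSums, ← hi, ← hj, hr]; ring
    exact ⟨s, e, f, _, by simp [Directed], hS, mk_eq_standard s e f i j r k m n hS⟩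

lemma standard_reaches {s e f : Bool} {k m n : ℤ} (w : ℕ) : ∀ L : List Letter, weight L = w →
    Directed s e f L → expSums L = (k + m, k, n) → (n ≠ 0 ∨ k = 0) →
    Relation.ReflTransGen (BasicMove k m n) (standard k m n) (FreeGroup.mk L) := by
  induction w using Nat.strong_induction_on with
  | _ w ih =>
    rintro L rfl h hk hn
    obtain ⟨i, rfl⟩ | ⟨i, j, r, rfl⟩ | ⟨u, z, y, e', f', hef, rfl, h2, h3⟩ :=
      h.eq_or_exists_carry
    · have h1 := expSums_replicate_append e [] i
      rw [List.append_nil, hk] at h1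
      simp [expSums] at h1
      obtain ⟨h1, rfl, rfl⟩ := h1
      rw [mk_replicate, standard, ← h1]
      simp [fb]
      rfl
    · rw [mk_eq_standard s e f i j r k m n hk]
    · exact (ih _ (weight_carry_lt u z y s e' f') _ rfl h2 (h3.trans hk) hn).tail
        (carry_basicMove hef h2 (h3.trans hk) h hk)

end CK

theorem theorem2 (k m n : ℤ) (h : n ≠ 0 ∨ k = 0) :
    CK.IsGeodesicRep (CK.standard k m n) (CK.elt k m n) ∧
      ∀ w : FreeGroup CK.Gen, CK.IsGeodesicRep w (CK.elt k m n) →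
        Relation.ReflTransGen (CK.BasicMove k m n) (CK.standard k m n) w := by
  obtain ⟨s, e, f, S, hS, hk, hmk⟩ := CK.exists_directed_standard k m n h
  refine ⟨hmk ▸ hS.isGeodesicRep hk, fun w hw => ?_⟩
  have := CK.standard_reaches _ w.toWord rfl (hw.directed hS hk) hw.expSums_toWord h
  rwa [FreeGroup.mk_toWord] at this
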